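/- Let $p$ be a prime, $C$ a field of characteristic $p$, and $D$ a finite-dimensional central division algebra over $C$ ($D=C$ is allowed). Let $\delta$ be a derivation of $D$; it maps $C$ into $C$. Put $F=\{c\in C : \delta(c)=0\}$, and assume that $\delta|_C$ is algebraic over $F$ with minimum polynomial $$g(t)=t^{p^e}+a_1t^{p^{e-1}}+\dots+a_et\in F[t].$$ Let $D[t;\delta]$ be the differential polynomial ring (left coefficients, $ta=at+\delta(a)$ for $a\in D$), let $d\in D$ and $f(t)=g(t)-d\in D[t;\delta]$. Let $S_f$ be the nonassociative $F$-algebra of all $h\in D[t;\delta]$ with $\deg h<\deg f$, with multiplication $h\circ k=$ the remainder $r$ of $hk=qf+r$, $\deg r<\deg f$. Let ${\rm Aut}_F(S_f)$ be its group of $F$-algebra automorphisms. For $b\in C$ let $G_{id,-b}\big(\sum_i c_it^i\big)=\sum_i c_i(t-b)^i$ ($c_i\in D$). For $b\in C$ and $j\ge 0$ let $V_{p^j}(b)=\sum_{i=0}^{j}\big(\delta^{p^i-1}(b)\big)^{p^{j-i}}\in C$ (so $V_1(b)=b$ and $V_p(b)=b^p+\delta^{p-1}(b)$), and let $$V(b)=V_{p^e}(b)+a_1V_{p^{e-1}}(b)+\dots+a_eb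 .$$ Then: 1. $(t-b)^{p^j}=t^{p^j}-V_{p^j}(b)$ in $D[t;\delta]$ for all $b\in C$ and $j\ge 0$. 2. $V$ is an additive map from $C$ to $F$; in particular $V(b)\in F$ for all $b\in C$. 3. $\ker(V)=\{b\in C : V(b)=0\}=\{\delta(c)/c : c\in C,\ c\neq 0\}$. 4. For every $b\in\ker(V)$ the map $G_{id,-b}$ restricts to an $F$-algebra automorphism of $S_f$. These automorphisms form a subgroup $\{G_{id,-b} : b\in C,\ V(b)=0\}$ of ${\rm Aut}_F(S_f)$, and $b\mapsto G_{id,-b}$ is a group isomorphism from the additive group $\ker(V)$ onto this subgroup. -/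

import Mathlib

/-- A derivation of a (not necessarily commutative) ring: an additive map with
`δ (a * b) = a * δ b + δ a * b`. -/
structure RingDerivation (D : Type*) [Ring D] extends D →+ D where
  leibniz' : ∀ a b : D, toFun (a * b) = a * toFun b + toFun a * b

namespace RingDerivation

variable {D : Type*} [Ring D] (δ : RingDerivation D)

instance : FunLike (RingDerivation D) D D where
  coe δ := δ.toFun
  coe_injective := by
    rintro ⟨⟨⟨f, _⟩, _⟩, _⟩ ⟨⟨⟨g, _⟩, _⟩, _⟩ h
    cases h
    rfl

instance : AddMonoidHomClass (RingDerivation D) D D where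
  map_add δ := δ.map_add'
  map_zero δ := δ.map_zero'

theorem leibniz (a b : D) : δ (a * b) = a * δ b + δ a * b := δ.leibniz' a b

theorem map_one_eq_zero : δ 1 = 0 := by
  have h := δ.leibniz 1 1
  simpa using h

end RingDerivation

open Polynomial in
/-- The differential polynomial ring `D[t;δ]`. Its elements are the polynomials `∑ aᵢ tⁱ` with
coefficients on the left, so it is `D[X]` as a left `D`-module; its multiplication is the one
with `t * a = a * t + δ a`. -/
def DiffPoly {D : Type*} [Ring D] (_δ : RingDerivation D) : Type _ := D[X]

namespace DiffPoly

open Polynomial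

section Multiplication

variable {D : Type*} [Ring D] (δ : RingDerivation D)

noncomputable instance : AddCommGroup (DiffPoly δ) := inferInstanceAs (AddCommGroup D[X])

noncomputable instance : Module D (DiffPoly δ) := inferInstanceAs (Module D D[X])

/-- The map `∑ aᵢ tⁱ ↦ ∑ δ(aᵢ) tⁱ`. -/
noncomputable def coeffDer : D[X] →+ D[X] where
  toFun h := h.sum fun i a => monomial i (δ a)
  map_zero' := by simp
  map_add' x y := by
    refine Polynomial.sum_add_index x y _ (fun i => by simp) (fun i a b => by simp)

/-- Left multiplication by `t`: `t * ∑ aᵢ tⁱ = ∑ aᵢ tⁱ⁺¹ + ∑ δ(aᵢ) tⁱ`. -/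
noncomputable def tMul : D[X] →+ D[X] where
  toFun h := h * X + coeffDer δ h
  map_zero' := by simp
  map_add' x y := by rw [add_mul, map_add]; abel

/-- The product in `D[t;δ]`: `(∑ aᵢ tⁱ) * h = ∑ aᵢ Tⁱ(h)`, where `T` is left multiplication
by `t`. -/
noncomputable def mulFun (f h : D[X]) : D[X] :=
  f.sum fun i a => Polynomial.C a * (tMul δ)^[i] h

theorem coeffDer_monomial (i : ℕ) (a : D) :
    coeffDer δ (monomial i a) = monomial i (δ a) := by
  simp [coeffDer, Polynomial.sum_monomial_index]

theorem tMul_apply (h : D[X]) : tMul δ h = h * X + coeffDer δ h := rfl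

theorem tMul_monomial (i : ℕ) (a : D) :
    tMul δ (monomial i a) = monomial (i + 1) a + monomial i (δ a) := by
  rw [tMul_apply, coeffDer_monomial, monomial_mul_X]

theorem mulFun_add_left (f g h : D[X]) : mulFun δ (f + g) h = mulFun δ f h + mulFun δ g h :=
  Polynomial.sum_add_index f g _ (fun i => by simp) (fun i a b => by rw [C_add, add_mul])

theorem mulFun_zero_left (h : D[X]) : mulFun δ 0 h = 0 := by simp [mulFun]

theorem mulFun_monomial (i : ℕ) (a : D) (h : D[X]) :
    mulFun δ (monomial i a) h = Polynomial.C a * (tMul δ)^[i] h := by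
  simp [mulFun, Polynomial.sum_monomial_index]

theorem mulFun_add_right (f g h : D[X]) : mulFun δ f (g + h) = mulFun δ f g + mulFun δ f h := by
  induction f using Polynomial.induction_on' with
  | add p q hp hq => rw [mulFun_add_left, mulFun_add_left, mulFun_add_left, hp, hq]; abel
  | monomial n b => simp only [mulFun_monomial, iterate_map_add, mul_add]

theorem mulFun_zero_right (f : D[X]) : mulFun δ f 0 = 0 := by
  simp [mulFun, iterate_map_zero, Polynomial.sum]

theorem tMul_C_mul (a : D) (h : D[X]) :
    tMul δ (Polynomial.C a * h) = Polynomial.C a * tMul δ h + Polynomial.C (δ a) * h := by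
  induction h using Polynomial.induction_on' with
  | add p q hp hq => rw [mul_add, map_add, hp, hq, map_add]; noncomm_ring
  | monomial n b =>
    rw [C_mul_monomial, tMul_monomial, tMul_monomial, mul_add, C_mul_monomial, C_mul_monomial,
      C_mul_monomial, δ.leibniz, map_add]
    abel

theorem mulFun_C_mul (a : D) (f h : D[X]) :
    mulFun δ (Polynomial.C a * f) h = Polynomial.C a * mulFun δ f h := by
  induction f using Polynomial.induction_on' with
  | add p q hp hq => rw [mul_add, mulFun_add_left, hp, hq, mulFun_add_left, mul_add]
  | monomial n b => rw [C_mul_monomial, mulFun_monomial, mulFun_monomial, C_mul, mul_assoc]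

theorem mulFun_tMul (f h : D[X]) : mulFun δ (tMul δ f) h = tMul δ (mulFun δ f h) := by
  induction f using Polynomial.induction_on' with
  | add p q hp hq => rw [map_add, mulFun_add_left, hp, hq, mulFun_add_left, map_add]
  | monomial n b =>
    rw [tMul_monomial, mulFun_add_left, mulFun_monomial, mulFun_monomial, mulFun_monomial,
      tMul_C_mul, Function.iterate_succ_apply']

theorem mulFun_assoc (f g h : D[X]) :
    mulFun δ (mulFun δ f g) h = mulFun δ f (mulFun δ g h) := by
  induction f using Polynomial.induction_on' with
  | add p q hp hq =>
    rw [mulFun_add_left, mulFun_add_left, mulFun_add_left, hp, hq]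
  | monomial n b =>
    rw [mulFun_monomial, mulFun_monomial, mulFun_C_mul]
    congr 1
    induction n with
    | zero => rfl
    | succ n ih => rw [Function.iterate_succ_apply', Function.iterate_succ_apply', mulFun_tMul, ih]

theorem mulFun_one_left (h : D[X]) : mulFun δ 1 h = h := by
  rw [← monomial_zero_one, mulFun_monomial]
  simp

theorem mulFun_one_right (f : D[X]) : mulFun δ f 1 = f := by
  induction f using Polynomial.induction_on' with
  | add p q hp hq => rw [mulFun_add_left, hp, hq]
  | monomial n b =>
    have key : ∀ k : ℕ, (tMul δ)^[k] (1 : D[X]) = monomial k 1 := by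
      intro k
      induction k with
      | zero => simp
      | succ k ih =>
        rw [Function.iterate_succ_apply', ih, tMul_monomial, δ.map_one_eq_zero]
        simp
    rw [mulFun_monomial, key n, C_mul_monomial, mul_one]

noncomputable instance : Ring (DiffPoly δ) where
  __ := (inferInstance : AddCommGroup (DiffPoly δ))
  mul := mulFun δ
  one := (1 : D[X])
  left_distrib := mulFun_add_right δ
  right_distrib := mulFun_add_left δ
  zero_mul := mulFun_zero_left δ
  mul_zero := mulFun_zero_right δ
  mul_assoc := mulFun_assoc δ
  one_mul := mulFun_one_left δ
  mul_one := mulFun_one_right δ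

/-- The differential polynomial with the given left coefficients. -/
def ofPoly (f : D[X]) : DiffPoly δ := f

variable {δ} in
/-- The polynomial of left coefficients of a differential polynomial. -/
def toPoly (f : DiffPoly δ) : D[X] := f

/-- The indeterminate `t`. -/
noncomputable def t : DiffPoly δ := ofPoly δ X

/-- The constant polynomial `a`. -/
noncomputable def const (a : D) : DiffPoly δ := ofPoly δ (Polynomial.C a)

theorem const_mul (a : D) (f : DiffPoly δ) : const δ a * f = a • f := by
  have h : ∀ g : D[X], mulFun δ (Polynomial.C a) g = a • g := by
    intro g
    rw [← monomial_zero_left, mulFun_monomial, Function.iterate_zero_apply, Polynomial.C_mul']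
  exact h f

theorem t_mul (f : DiffPoly δ) : t δ * f = ofPoly δ (tMul δ (toPoly f)) := by
  have h : ∀ g : D[X], mulFun δ X g = tMul δ g := by
    intro g
    rw [← monomial_one_one_eq_X, mulFun_monomial, Function.iterate_one, C_1, one_mul]
  exact h f

/-- The defining relation `t a = a t + δ(a)`. -/
theorem t_mul_const (a : D) : t δ * const δ a = const δ a * t δ + const δ (δ a) := by
  rw [t_mul, const_mul]
  have h := tMul_monomial δ 0 a
  rw [monomial_zero_left, monomial_zero_left, zero_add, ← C_mul_X_eq_monomial,
    Polynomial.C_mul'] at h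
  exact h

/-- The map `G_{τ,a} : ∑ bᵢ tⁱ ↦ ∑ τ(bᵢ) (t + a)ⁱ` on `D[t;δ]`. -/
noncomputable def G (τ : D ≃+* D) (a : D) (f : DiffPoly δ) : DiffPoly δ :=
  (toPoly f).sum fun i b => const δ (τ b) * (t δ + const δ a) ^ i

theorem coeff_coeffDer (h : D[X]) (n : ℕ) : (coeffDer δ h).coeff n = δ (h.coeff n) := by
  induction h using Polynomial.induction_on' with
  | add p q hp hq => rw [map_add, coeff_add, hp, hq, coeff_add, map_add]
  | monomial k b =>
    rw [coeffDer_monomial, coeff_monomial, coeff_monomial]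
    split_ifs <;> simp

theorem coeff_iterate_tMul (k : ℕ) (h : D[X]) (N : ℕ) (hN : h.natDegree ≤ N) :
    ((tMul δ)^[k] h).natDegree ≤ N + k ∧ ((tMul δ)^[k] h).coeff (N + k) = h.coeff N := by
  induction k with
  | zero => exact ⟨hN, rfl⟩
  | succ k ih =>
    rw [Function.iterate_succ_apply']
    obtain ⟨h1, h2⟩ := ih
    generalize (tMul δ)^[k] h = u at h1 h2 ⊢
    have hc : ∀ n, (tMul δ u).coeff (n + 1) = u.coeff n + δ (u.coeff (n + 1)) := by
      intro n
      rw [tMul_apply, coeff_add, coeff_mul_X, coeff_coeffDer]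
    rw [natDegree_le_iff_coeff_eq_zero] at h1 ⊢
    constructor
    · intro n hn
      obtain ⟨n, rfl⟩ : ∃ j, n = j + 1 := ⟨n - 1, by omega⟩
      rw [hc, h1 n (by omega), h1 (n + 1) (by omega), map_zero, add_zero]
    · rw [← add_assoc, hc, h2, h1 (N + k + 1) (by omega), map_zero, add_zero]

theorem coeff_mulFun (f g : D[X]) (M N : ℕ) (hM : f.natDegree ≤ M) (hN : g.natDegree ≤ N) :
    (mulFun δ f g).natDegree ≤ M + N ∧
      (mulFun δ f g).coeff (M + N) = f.coeff M * g.coeff N := by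
  have hs : mulFun δ f g
      = ∑ i ∈ Finset.range (M + 1), Polynomial.C (f.coeff i) * (tMul δ)^[i] g :=
    Polynomial.sum_over_range' f (by simp) (M + 1) (by omega)
  have hv : ∀ i n, N + i < n → ((tMul δ)^[i] g).coeff n = 0 := fun i n hn =>
    natDegree_le_iff_coeff_eq_zero.1 (coeff_iterate_tMul δ i g N hN).1 n hn
  constructor
  · rw [natDegree_le_iff_coeff_eq_zero]
    intro n hn
    rw [hs, finsetSum_coeff]
    refine Finset.sum_eq_zero fun i hi => ?_
    rw [Finset.mem_range] at hi
    rw [coeff_C_mul, hv i n (by omega), mul_zero]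
  · rw [hs, finsetSum_coeff, Finset.sum_eq_single M]
    · rw [coeff_C_mul, add_comm M N, (coeff_iterate_tMul δ M g N hN).2]
    · intro i hi hne
      rw [Finset.mem_range] at hi
      rw [coeff_C_mul, hv i (M + N) (by omega), mul_zero]
    · intro h
      simp at h

end Multiplication

section Division

variable {D : Type*} [DivisionRing D] {δ : RingDerivation D}

/-- Existence in the right division algorithm. -/
theorem exists_rightDivision (f g : DiffPoly δ) (hf : f ≠ 0) :
    ∃ q r : DiffPoly δ, g = q * f + r ∧ (toPoly r).degree < (toPoly f).degree := by
  have hf' : toPoly f ≠ 0 := hf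
  have main : ∀ (N : ℕ) (g : D[X]), g.degree < N → ∃ q r : D[X],
      g = mulFun δ q (toPoly f) + r ∧ r.degree < (toPoly f).degree := by
    generalize toPoly f = f at hf'
    intro N
    induction N with
    | zero =>
      intro g hg
      have : g = 0 := by
        rw [← degree_eq_bot]
        exact Nat.WithBot.lt_zero_iff.1 hg
      refine ⟨0, 0, ?_, ?_⟩
      · rw [this, mulFun_zero_left, add_zero]
      · rw [degree_zero]
        exact bot_lt_iff_ne_bot.2 (mt degree_eq_bot.1 hf')
    | succ N ih =>
      intro g hg
      by_cases hd : g.degree < f.degree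
      · exact ⟨0, g, by rw [mulFun_zero_left, zero_add], hd⟩
      · have hfN : f.natDegree ≤ N := by
          have h1 := lt_of_le_of_lt (not_lt.1 hd) hg
          rw [degree_eq_natDegree hf'] at h1
          have h2 : f.natDegree < N + 1 := by exact_mod_cast h1
          omega
        have hgN : g.natDegree ≤ N := natDegree_le_iff_degree_le.2 (by
          refine Order.le_of_lt_succ ?_
          exact hg)
        set q₁ : D[X] := monomial (N - f.natDegree) (g.coeff N * f.leadingCoeff⁻¹) with hq₁
        obtain ⟨h1, h2⟩ := coeff_mulFun δ q₁ f (N - f.natDegree) f.natDegree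
          (natDegree_monomial_le _) le_rfl
        rw [Nat.sub_add_cancel hfN] at h1 h2
        have h3 : (mulFun δ q₁ f).coeff N = g.coeff N := by
          rw [h2, hq₁, coeff_monomial, if_pos rfl, coeff_natDegree, mul_assoc,
            inv_mul_cancel₀ (leadingCoeff_ne_zero.2 hf'), mul_one]
        have h4 : (g - mulFun δ q₁ f).degree < N := by
          rw [degree_lt_iff_coeff_zero]
          intro n hn
          rw [coeff_sub]
          rcases hn.eq_or_lt with rfl | hn
          · rw [h3, sub_self]
          · rw [natDegree_le_iff_coeff_eq_zero.1 hgN n hn,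
              natDegree_le_iff_coeff_eq_zero.1 h1 n hn, sub_zero]
        obtain ⟨q₂, r, h5, h6⟩ := ih _ h4
        refine ⟨q₁ + q₂, r, ?_, h6⟩
        rw [mulFun_add_left, add_assoc, ← h5]
        abel
  obtain ⟨q, r, h1, h2⟩ := main ((toPoly g).natDegree + 1) (toPoly g) (by
    refine lt_of_le_of_lt degree_le_natDegree ?_
    exact_mod_cast Nat.lt_succ_self _)
  exact ⟨q, r, h1, h2⟩

/-- Uniqueness of the remainder in the right division algorithm. -/
theorem rightDivision_unique (f q q' r r' : DiffPoly δ) (h : q * f + r = q' * f + r')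
    (hr : (toPoly r).degree < (toPoly f).degree)
    (hr' : (toPoly r').degree < (toPoly f).degree) : r = r' := by
  have hf : toPoly f ≠ 0 := by
    intro h0
    rw [h0, degree_zero] at hr
    exact not_lt_bot hr
  have h1 : (q - q') * f = r' - r := by
    rw [sub_mul, sub_eq_sub_iff_add_eq_add, add_comm r']
    rw [h, add_comm]
  have h2 : mulFun δ (toPoly (q - q')) (toPoly f) = toPoly r' - toPoly r := h1
  obtain ⟨_, h4⟩ := coeff_mulFun δ (toPoly (q - q')) (toPoly f) _ _ le_rfl le_rfl
  have h5 : (toPoly r' - toPoly r).degree < (toPoly f).degree :=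
    (degree_sub_le _ _).trans_lt (max_lt hr' hr)
  rw [degree_eq_natDegree hf] at h5
  rw [h2, coeff_natDegree, coeff_natDegree,
    coeff_eq_zero_of_degree_lt (h5.trans_le (by exact_mod_cast Nat.le_add_left _ _))] at h4
  have h6 : toPoly (q - q') = 0 := by
    rcases mul_eq_zero.1 h4.symm with h | h
    · exact leadingCoeff_eq_zero.1 h
    · exact absurd (leadingCoeff_eq_zero.1 h) hf
  rw [h6, mulFun_zero_left] at h2
  exact (sub_eq_zero.1 h2.symm).symm

open Classical in
/-- The remainder `g mod_r f` of the right division of `g` by `f`: the unique `r` with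
`deg r < deg f` and `g = q f + r` for some `q` (and `0` if `f = 0`). -/
noncomputable def modRight (g f : DiffPoly δ) : DiffPoly δ :=
  if hf : f = 0 then 0 else (exists_rightDivision f g hf).choose_spec.choose

theorem modRight_spec (g f : DiffPoly δ) (hf : f ≠ 0) :
    (∃ q, g = q * f + modRight g f) ∧ (toPoly (modRight g f)).degree < (toPoly f).degree := by
  rw [modRight, dif_neg hf]
  have h := (exists_rightDivision f g hf).choose_spec.choose_spec
  exact ⟨⟨_, h.1⟩, h.2⟩

theorem modRight_eq {f g q r : DiffPoly δ} (h : g = q * f + r)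
    (hr : (toPoly r).degree < (toPoly f).degree) : modRight g f = r := by
  have hf : f ≠ 0 := by
    rintro rfl
    exact not_lt_bot (show (toPoly r).degree < ⊥ by
      have h0 : (toPoly (0 : DiffPoly δ)).degree = ⊥ := degree_zero
      rwa [h0] at hr)
  obtain ⟨⟨q', h1⟩, h2⟩ := modRight_spec g f hf
  exact rightDivision_unique f q' q _ _ (h1.symm.trans h) h2 hr

theorem modRight_add (f g h : DiffPoly δ) :
    modRight (g + h) f = modRight g f + modRight h f := by
  by_cases hf : f = 0
  · simp [modRight, hf]
  · obtain ⟨⟨q, h1⟩, h2⟩ := modRight_spec g f hf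
    obtain ⟨⟨q', h3⟩, h4⟩ := modRight_spec h f hf
    refine modRight_eq (q := q + q') ?_ ?_
    · conv_lhs => rw [h1, h3]
      rw [add_mul]
      abel
    · exact (degree_add_le _ _).trans_lt (max_lt h2 h4)

theorem modRight_zero (f : DiffPoly δ) : modRight 0 f = 0 := by
  have h := modRight_add f 0 0
  simpa using h

theorem modRight_smul (a : D) (f g : DiffPoly δ) : modRight (a • g) f = a • modRight g f := by
  by_cases hf : f = 0
  · simp [modRight, hf]
  · obtain ⟨⟨q, h1⟩, h2⟩ := modRight_spec g f hf
    refine modRight_eq (q := a • q) ?_ ?_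
    · conv_lhs => rw [h1]
      rw [smul_add, ← const_mul, ← const_mul, ← const_mul, mul_assoc]
    · exact (degree_smul_le _ _).trans_lt h2

end Division

end DiffPoly

open Polynomial in
/-- The underlying space `R_m = {g ∈ D[t;δ] : deg g < m}`, `m = deg f`, of the Petit algebra
`S_f`. The alternative `g = 0` only matters for `f = 0`, since `deg 0 = -∞`. -/
def petitSubmodule {D : Type*} [DivisionRing D] {δ : RingDerivation D} (f : DiffPoly δ) :
    Submodule D (DiffPoly δ) where
  carrier := {g | g.toPoly.degree < f.toPoly.degree ∨ g = 0}
  add_mem' := by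
    rintro x y (hx | rfl) (hy | rfl)
    · exact Or.inl ((degree_add_le _ _).trans_lt (max_lt hx hy))
    · exact Or.inl (by rwa [add_zero])
    · exact Or.inl (by rwa [zero_add])
    · exact Or.inr (add_zero 0)
  zero_mem' := Or.inr rfl
  smul_mem' := by
    rintro a x (hx | rfl)
    · exact Or.inl ((degree_smul_le _ _).trans_lt hx)
    · exact Or.inr (smul_zero a)

/-- The Petit algebra `S_f`: the space `R_m` of differential polynomials of degree less than
`m = deg f`, with the multiplication `g ∘ h = g h mod_r f`. -/
def PetitAlgebra {D : Type*} [DivisionRing D] {δ : RingDerivation D} (f : DiffPoly δ) : Type _ :=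
  petitSubmodule f

namespace PetitAlgebra

variable {D : Type*} [DivisionRing D] {δ : RingDerivation D} {f : DiffPoly δ}

/-- An element of `S_f` as an element of `D[t;δ]`. -/
def val (x : PetitAlgebra f) : DiffPoly δ := Subtype.val (p := (· ∈ petitSubmodule f)) x

theorem val_injective : Function.Injective (val : PetitAlgebra f → DiffPoly δ) :=
  Subtype.val_injective

noncomputable instance : AddCommGroup (PetitAlgebra f) :=
  inferInstanceAs (AddCommGroup (petitSubmodule f))

noncomputable instance : Module D (PetitAlgebra f) :=
  inferInstanceAs (Module D (petitSubmodule f))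

theorem modRight_mem (f g : DiffPoly δ) : DiffPoly.modRight g f ∈ petitSubmodule f := by
  by_cases hf : f = 0
  · exact Or.inr (by simp [DiffPoly.modRight, hf])
  · exact Or.inl (DiffPoly.modRight_spec g f hf).2

noncomputable instance : Mul (PetitAlgebra f) :=
  ⟨fun x y => (⟨DiffPoly.modRight (x.val * y.val) f, modRight_mem f _⟩ : petitSubmodule f)⟩

theorem val_mul (x y : PetitAlgebra f) : (x * y).val = DiffPoly.modRight (x.val * y.val) f := rfl

theorem val_add (x y : PetitAlgebra f) : (x + y).val = x.val + y.val := rfl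

theorem val_zero : (0 : PetitAlgebra f).val = 0 := rfl

theorem val_smul (a : D) (x : PetitAlgebra f) : (a • x).val = a • x.val := rfl

noncomputable instance : NonUnitalNonAssocRing (PetitAlgebra f) where
  __ := (inferInstance : AddCommGroup (PetitAlgebra f))
  left_distrib x y z := val_injective (by
    simp only [val_add, val_mul, mul_add, DiffPoly.modRight_add])
  right_distrib x y z := val_injective (by
    simp only [val_add, val_mul, add_mul, DiffPoly.modRight_add])
  zero_mul x := val_injective (by simp only [val_mul, val_zero, zero_mul, DiffPoly.modRight_zero])
  mul_zero x := val_injective (by simp only [val_mul, val_zero, mul_zero, DiffPoly.modRight_zero])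

end PetitAlgebra

namespace RingDerivation

variable (C : Type*) {D : Type*} [Field C] [DivisionRing D] [Algebra C D] [Algebra.IsCentral C D]
  (δ : RingDerivation D)

theorem exists_center (c : C) : ∃ c' : C, algebraMap C D c' = δ (algebraMap C D c) := by
  have h : δ (algebraMap C D c) ∈ Subalgebra.center C D := by
    rw [Subalgebra.mem_center_iff]
    intro x
    have h1 := δ.leibniz (algebraMap C D c) x
    have h2 := δ.leibniz x (algebraMap C D c)
    rw [← Algebra.commutes c x] at h2
    rw [h2, ← Algebra.commutes c (δ x), add_comm] at h1
    exact add_left_cancel h1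
  exact Algebra.mem_bot.1 (Algebra.IsCentral.out h)

/-- The map underlying `δ|_C`: the unique `c' ∈ C` whose image in `D` is `δ(c)`. -/
noncomputable def centerFun (c : C) : C := (exists_center C δ c).choose

theorem algebraMap_centerFun (c : C) :
    algebraMap C D (centerFun C δ c) = δ (algebraMap C D c) :=
  (exists_center C δ c).choose_spec

/-- The restriction `δ|_C` of a derivation of `D` to the center `C` of `D`. -/
noncomputable def centerDer : Derivation ℤ C C :=
  Derivation.mk'
    (AddMonoidHom.toIntLinearMap
      { toFun := centerFun C δ
        map_zero' := (algebraMap C D).injective (by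
          rw [algebraMap_centerFun, map_zero, map_zero])
        map_add' := fun x y => (algebraMap C D).injective (by
          rw [map_add, algebraMap_centerFun, algebraMap_centerFun, algebraMap_centerFun, map_add,
            map_add]) })
    (fun x y => (algebraMap C D).injective (by
      change algebraMap C D (centerFun C δ (x * y))
        = algebraMap C D (x * centerFun C δ y + y * centerFun C δ x)
      rw [map_add, map_mul, map_mul, algebraMap_centerFun, algebraMap_centerFun,
        algebraMap_centerFun, map_mul, leibniz, Algebra.commutes y]))

theorem algebraMap_centerDer (c : C) :
    algebraMap C D (centerDer C δ c) = δ (algebraMap C D c) :=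
  algebraMap_centerFun C δ c

/-- The field of constants `F = {c ∈ C : δ(c) = 0}`. -/
noncomputable def constField : Subfield C where
  carrier := {c | centerDer C δ c = 0}
  mul_mem' {x y} hx hy := by
    have hx' : centerDer C δ x = 0 := hx
    have hy' : centerDer C δ y = 0 := hy
    simp [hx', hy']
  one_mem' := by simp
  add_mem' {x y} hx hy := by
    have hx' : centerDer C δ x = 0 := hx
    have hy' : centerDer C δ y = 0 := hy
    simp [hx', hy']
  zero_mem' := by simp
  neg_mem' {x} hx := by
    have hx' : centerDer C δ x = 0 := hx
    simp [hx']
  inv_mem' x hx := by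
    have hx' : centerDer C δ x = 0 := hx
    simp [Derivation.leibniz_inv, hx']

/-- `δ|_C` as an `F`-linear endomorphism of `C`. -/
noncomputable def centerEnd : Module.End (constField C δ) C where
  toFun := centerDer C δ
  map_add' := map_add _
  map_smul' a x := by
    have ha : centerDer C δ (a : C) = 0 := a.2
    simp [Subfield.smul_def, ha]

/-- The embedding of the field of constants `F` into `D`. -/
noncomputable def constEmb : constField C δ →+* D :=
  (algebraMap C D).comp (constField C δ).subtype

variable (p : ℕ) [Fact p.Prime] [CharP C p]

/-- The additive map `V_{p^j}` on `C`, characterized by `(t - b)^(p^j) = t^(p^j) - V_{p^j}(b)`: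
`V_{p^j}(b) = ∑_{i ≤ j} (δ^{p^i - 1}(b))^{p^{j-i}}`. In particular `V_1(b) = b` and
`V_p(b) = b^p + δ^{p-1}(b)`. -/
noncomputable def Vpow (j : ℕ) : C →+ C where
  toFun b := ∑ i ∈ Finset.range (j + 1), ((centerDer C δ)^[p ^ i - 1] b) ^ p ^ (j - i)
  map_zero' := Finset.sum_eq_zero fun i _ => by
    rw [iterate_map_zero, zero_pow (pow_ne_zero _ (Fact.out : p.Prime).ne_zero)]
  map_add' x y := by
    rw [← Finset.sum_add_distrib]
    refine Finset.sum_congr rfl fun i _ => ?_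
    rw [iterate_map_add, add_pow_char_pow]

/-- The map `V = V_g` on `C` for the `p`-polynomial
`g(t) = t^{p^e} + a₁ t^{p^{e-1}} + ⋯ + a_e t` over `F`:
`V(b) = V_{p^e}(b) + a₁ V_{p^{e-1}}(b) + ⋯ + a_e b`. -/
noncomputable def V (e : ℕ) (a : ℕ → constField C δ) : C →+ C :=
  Vpow C δ p e + ∑ i ∈ Finset.Icc 1 e, (AddMonoidHom.mulLeft (a i : C)).comp (Vpow C δ p (e - i))

end RingDerivation

namespace PetitAlgebra

variable (C : Type*) {D : Type*} [Field C] [DivisionRing D] [Algebra C D] [Algebra.IsCentral C D]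
  {δ : RingDerivation D}

noncomputable instance (f : DiffPoly δ) : Module (δ.constField C) (PetitAlgebra f) :=
  Module.compHom _ (δ.constEmb C)

variable {C} in
theorem constField_smul_def {f : DiffPoly δ} (a : δ.constField C) (x : PetitAlgebra f) :
    a • x = δ.constEmb C a • x := rfl

open Polynomial in
variable {C} in
theorem const_commute (a : δ.constField C) (x : DiffPoly δ) :
    x * DiffPoly.const δ (δ.constEmb C a) = DiffPoly.const δ (δ.constEmb C a) * x := by
  have hδ : δ (δ.constEmb C a) = 0 := by
    have h : δ.centerDer C (a : C) = 0 := a.2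
    change δ (algebraMap C D (a : C)) = 0
    rw [← RingDerivation.algebraMap_centerDer, h, map_zero]
  have hc : ∀ b : D, b * δ.constEmb C a = δ.constEmb C a * b := fun b =>
    (Algebra.commutes (a : C) b).symm
  generalize δ.constEmb C a = u at hδ hc ⊢
  have main : ∀ g : D[X], DiffPoly.mulFun δ g (Polynomial.C u) = u • g := by
    intro g
    induction g using Polynomial.induction_on' with
    | add p q hp hq => rw [DiffPoly.mulFun_add_left, hp, hq, smul_add]
    | monomial n b =>
      have key : ∀ k : ℕ, (DiffPoly.tMul δ)^[k] (Polynomial.C u) = monomial k u := by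
        intro k
        induction k with
        | zero => simp
        | succ k ih =>
          rw [Function.iterate_succ_apply', ih, DiffPoly.tMul_monomial, hδ]
          simp
      rw [DiffPoly.mulFun_monomial, key n, C_mul_monomial, hc, smul_monomial, smul_eq_mul]
  rw [DiffPoly.const_mul]
  exact main x

instance (f : DiffPoly δ) : IsScalarTower (δ.constField C) (PetitAlgebra f) (PetitAlgebra f) where
  smul_assoc a x y := val_injective (by
    simp only [smul_eq_mul, constField_smul_def, val_smul, val_mul, ← DiffPoly.const_mul,
      mul_assoc]
    rw [DiffPoly.const_mul, DiffPoly.const_mul, DiffPoly.modRight_smul])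

instance (f : DiffPoly δ) : SMulCommClass (δ.constField C) (PetitAlgebra f) (PetitAlgebra f) where
  smul_comm a x y := val_injective (by
    simp only [smul_eq_mul, constField_smul_def, val_smul, val_mul, ← DiffPoly.const_mul]
    rw [← mul_assoc, const_commute, mul_assoc, DiffPoly.const_mul, DiffPoly.const_mul,
      DiffPoly.modRight_smul])

/-- The group `Aut_F(S_f)` of `F`-algebra automorphisms of `S_f`: the multiplicative bijective
`F`-linear maps `S_f → S_f`, under composition. -/
def autF (f : DiffPoly δ) :
    Subgroup (PetitAlgebra f ≃ₗ[δ.constField C] PetitAlgebra f) where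
  carrier := {φ | ∀ x y, φ (x * y) = φ x * φ y}
  mul_mem' {φ ψ} hφ hψ x y := by
    rw [LinearEquiv.mul_apply, LinearEquiv.mul_apply, LinearEquiv.mul_apply, hψ x y, hφ]
  one_mem' _ _ := rfl
  inv_mem' {φ} hφ x y := φ.injective (by
    have h : ∀ z, φ (φ⁻¹ z) = z := φ.apply_symm_apply
    rw [hφ, h, h, h])

end PetitAlgebra

/-! The engine is one identity, valid in any ring of characteristic `p` containing an image of `C`
and an element `x` with `x c = c x + δ(c)`: for the `p`-polynomial `g`, `g(x - b) = g(x) - V(b)`. It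
comes from Jacobson's formula. Since `b` and its derivatives commute with each other, `(x - b)^p =
x^p - b^p - δ^{p-1}(b)`. As `ad(x)^p = ad(x^p)` in characteristic `p`, the element `x^{p^j}` induces
`δ^{p^j}`, so the formula can be iterated (`sub_pow_char_pow_of_commutation`).

The identity is used in two rings. For `x = t` in `D[t;δ]`, it gives the power formula, and it shows
that the substitution `t ↦ t - b` fixes `f = g(t) - d` when `V(b) = 0`. This substitution is a ring
endomorphism because `b` is central, and it does not raise degrees. Hence it commutes with taking
remainders modulo `f`, so it restricts to an algebra map of `S_f`, with inverse the shift by `-b`.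

For `x = δ` in `End_F(C)`, where `g(δ) = 0`, it gives `g(δ - b) = -V(b)`. Write `g = X q`. If `b =
δ(c)/c`, then `δ - b` kills `c`, hence so does `V(b)`, and `V(b) = 0`. Conversely, if `V(b) = 0` and
`δ - b` were injective, then `q(δ - b) = 0`. This is impossible: the powers of `δ` below `deg g` are
linearly independent over `C`, not only over `F`.

That `V(b)` is a constant follows from `δ(V(b)) = g(δ)(b) = 0`, because `δ` kills `p`-th powers. -/

/-! ### Jacobson's formula for `p`-th powers. -/

section PthPowers

open Polynomial

/-- Leibniz rule for the powers of `y`, if `u 0` is the derivative of `y` and `u (k + 1)` is the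
commutator of `y` and `u k`. -/
theorem Polynomial.derivative_pow_eq_sum_choose {R : Type*} [Ring R] (y : R[X]) (u : ℕ → R[X])
    (hy : derivative y = u 0) (hu : ∀ k, y * u k = u k * y + u (k + 1)) (n : ℕ) :
    derivative (y ^ n) =
      ∑ j ∈ Finset.range n, (n.choose (j + 1) : R[X]) * (u j * y ^ (n - 1 - j)) := by
  induction n with
  | zero => simp
  | succ n ih =>
    -- Moving `y` past `u j` yields two sums. The term `u 0 * y ^ n` from the first factor fills
    -- index 0 of the shifted sum (`h4`), the other is padded by `n.choose (n + 1) = 0` (`h5`), and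
    -- Pascal's rule merges them.
    have h1 : y * derivative (y ^ n)
        = ∑ j ∈ Finset.range n, (n.choose (j + 1) : R[X]) * (u j * y ^ (n - j))
          + ∑ j ∈ Finset.range n, (n.choose (j + 1) : R[X]) * (u (j + 1) * y ^ (n - (j + 1))) := by
      rw [ih, Finset.mul_sum, ← Finset.sum_add_distrib]
      refine Finset.sum_congr rfl fun j hj => ?_
      rw [Finset.mem_range] at hj
      have h2 : n - j = (n - 1 - j) + 1 := by omega
      have h3 : n - (j + 1) = n - 1 - j := by omega
      rw [← mul_assoc, (Nat.commute_cast y _).eq, mul_assoc, ← mul_assoc y, hu, add_mul, mul_assoc,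
        ← pow_succ', h2, h3, mul_add]
    have h4 : ∑ j ∈ Finset.range (n + 1), (n.choose j : R[X]) * (u j * y ^ (n - j))
        = u 0 * y ^ n
          + ∑ j ∈ Finset.range n, (n.choose (j + 1) : R[X]) * (u (j + 1) * y ^ (n - (j + 1))) := by
      rw [Finset.sum_range_succ', add_comm]
      simp
    have h5 : ∑ j ∈ Finset.range (n + 1), (n.choose (j + 1) : R[X]) * (u j * y ^ (n - j))
        = ∑ j ∈ Finset.range n, (n.choose (j + 1) : R[X]) * (u j * y ^ (n - j)) := by
      rw [Finset.sum_range_succ]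
      simp
    rw [pow_succ', derivative_mul, hy, h1, ← h5, add_left_comm, ← h4, ← Finset.sum_add_distrib]
    refine Finset.sum_congr rfl fun j _ => ?_
    rw [Nat.choose_succ_succ', Nat.cast_add, add_mul, add_comm, Nat.add_sub_cancel]

/-- Every binomial coefficient in the Leibniz sum is divisible by `p` except the last, `p.choose p =
1`. -/
theorem Polynomial.derivative_pow_char {R : Type*} [Ring R] (p : ℕ) [Fact p.Prime] [CharP R p]
    (y : R[X]) (u : ℕ → R[X]) (hy : derivative y = u 0)
    (hu : ∀ k, y * u k = u k * y + u (k + 1)) : derivative (y ^ p) = u (p - 1) := by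
  have hp : p.Prime := Fact.out
  rw [derivative_pow_eq_sum_choose y u hy hu, Finset.sum_eq_single (p - 1)]
  · rw [Nat.sub_add_cancel hp.one_le]
    simp
  · intro j hj hne
    rw [Finset.mem_range] at hj
    rw [(CharP.cast_eq_zero_iff R[X] p _).2 (hp.dvd_choose_self (by omega) (by omega)), zero_mul]
  · intro h
    exact absurd (Finset.mem_range.2 (Nat.sub_lt hp.pos one_pos)) h

/-- Jacobson's formula for `(x + c) ^ p`, if `c` commutes with its iterated commutators with
`x`. -/
theorem add_pow_char_of_commutator {R : Type*} [Ring R] (p : ℕ) [Fact p.Prime] [CharP R p]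
    (x : R) (u : ℕ → R) (hc : ∀ k, Commute (u 0) (u k))
    (hu : ∀ k, x * u k = u k * x + u (k + 1)) :
    (x + u 0) ^ p = x ^ p + u 0 ^ p + u (p - 1) := by
  have hp : p.Prime := Fact.out
  set c := u 0 with hc0
  -- The central variable `X` separates the terms of `(x + c) ^ p` by their degree in `c`;
  -- evaluating at 1 recovers the power, and the derivative determines all coefficients strictly
  -- between 0 and `p`.
  set y : R[X] := C x + C c * X with hy
  have hd : derivative (y ^ p) = C (u (p - 1)) := by
    refine derivative_pow_char p y (fun k => C (u k)) (by simp [hy, hc0]) fun k => ?_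
    have h1 : C c * X * C (u k) = C (u k) * (C c * X) := by
      rw [mul_assoc, X_mul_C, ← mul_assoc, ← mul_assoc, ← C_mul, ← C_mul, (hc k).eq]
    rw [hy, add_mul, mul_add, h1, ← C_mul, hu, C_add, C_mul]
    abel
  have hdeg : ∀ n, (y ^ n).natDegree ≤ n ∧ (y ^ n).coeff n = c ^ n := by
    have hy1 : y.natDegree ≤ 1 := by
      rw [hy, natDegree_le_iff_coeff_eq_zero]
      intro N hN
      rw [coeff_add, coeff_C_mul, coeff_C, coeff_X, if_neg (by omega), if_neg (by omega)]
      simp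
    intro n
    induction n with
    | zero => simp
    | succ n ih =>
      refine ⟨natDegree_pow_le_of_le _ hy1 |>.trans (by simp), ?_⟩
      rw [pow_succ, coeff_mul_add_eq_of_natDegree_le ih.1 hy1, ih.2, hy, pow_succ]
      simp [coeff_C]
  have h0 : (y ^ p).coeff 0 = x ^ p := by
    rw [coeff_zero_eq_eval_zero]
    have h := map_pow (eval₂RingHom' (RingHom.id R) 0 fun a => Commute.zero_right _) y p
    change eval 0 (y ^ p) = (eval 0 y) ^ p at h
    rw [h, hy]
    simp
  have h1 : eval 1 (y ^ p) = (x + c) ^ p := by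
    have h := map_pow (eval₂RingHom' (RingHom.id R) 1 fun a => Commute.one_right _) y p
    change eval 1 (y ^ p) = (eval 1 y) ^ p at h
    rw [h, hy]
    simp
  have hk : ∀ k, k + 1 < p → (y ^ p).coeff (k + 1) = if k = 0 then u (p - 1) else 0 := by
    intro k hk
    have h2 : (y ^ p).coeff (k + 1) * ((k + 1 : ℕ) : R) = if k = 0 then u (p - 1) else 0 := by
      have h := congrArg (fun q => coeff q k) hd
      simp only [coeff_derivative, coeff_C] at h
      exact_mod_cast h
    -- The derivative only determines the coefficient times `k + 1`, which is invertible because `0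
    -- < k + 1 < p`.
    have h3 : IsUnit ((k + 1 : ℕ) : R) :=
      (CharP.isUnit_natCast_iff hp).2 fun h => by
        have := Nat.le_of_dvd (Nat.succ_pos k) h
        omega
    rcases eq_or_ne k 0 with rfl | hne
    · simpa using h2
    · rw [if_neg hne] at h2 ⊢
      exact h3.mul_left_eq_zero.1 h2
  rw [← h1, eval_eq_sum_range' (Nat.lt_succ_of_le (hdeg p).1), Finset.sum_range_succ, (hdeg p).2]
  obtain ⟨m, rfl⟩ : ∃ m, p = m + 2 := ⟨p - 2, by have := hp.two_le; omega⟩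
  rw [Finset.sum_range_succ', Finset.sum_eq_single 0, h0, hk 0 (by omega)]
  · simp
    abel
  · intro k hk1 hk2
    rw [hk k (by simpa using hk1), if_neg hk2, zero_mul]
  · simp

/-- Left and right multiplication by `x` commute, so in characteristic `p` the `p`-th power of their
difference `ad(x)` is `ad(x ^ p)`. -/
theorem pow_mul_eq_mul_pow_add_iterate {R A : Type*} [Ring R] [Ring A] (p : ℕ) [Fact p.Prime]
    [CharP R p] (φ : A →+* R) (x : R) (δ : A → A)
    (hx : ∀ a, x * φ a = φ a * x + φ (δ a)) (a : A) :
    x ^ p * φ a = φ a * x ^ p + φ (δ^[p] a) := by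
  have : CharP (Module.End ℤ R) p :=
    charP_of_injective_ringHom (f := (Algebra.lmul ℤ R).toRingHom) Algebra.lmul_injective p
  have hL : ∀ k, (LinearMap.mulLeft ℤ x - LinearMap.mulRight ℤ x) ^ k • φ a = φ (δ^[k] a) := by
    intro k
    induction k with
    | zero => simp
    | succ k ih =>
      rw [pow_succ', mul_smul, ih, Function.iterate_succ_apply']
      simp [hx]
  have h := hL p
  rw [sub_pow_char_of_commute _ (LinearMap.commute_mulLeft_right x x), LinearMap.pow_mulLeft,
    LinearMap.pow_mulRight] at h
  rw [← h]
  simp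

/-- The formula for `(x - b) ^ p` in terms of the commutation rule of `x`. -/
theorem sub_pow_char_of_commutation {R A : Type*} [Ring R] [CommRing A] (p : ℕ) [Fact p.Prime]
    [CharP R p] (φ : A →+* R) (x : R) (δ : A → A) (hδ : ∀ a, δ (-a) = -δ a)
    (hx : ∀ a, x * φ a = φ a * x + φ (δ a)) (b : A) :
    (x - φ b) ^ p = x ^ p - φ (b ^ p + δ^[p - 1] b) := by
  have hp : p.Prime := Fact.out
  have h := add_pow_char_of_commutator p x (fun k => φ (δ^[k] (-b)))
    (fun k => by simpa only [Commute, SemiconjBy, ← map_mul] using congrArg φ (mul_comm _ _))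
    (fun k => by simp only [hx, Function.iterate_succ_apply'])
  have hneg : (-φ b) ^ p = -φ b ^ p := by
    rw [neg_pow, neg_one_pow_char, neg_one_mul]
  have hit : ∀ n, δ^[n] (-b) = -δ^[n] b := fun n => by
    induction n with
    | zero => rfl
    | succ n ih => rw [Function.iterate_succ_apply', Function.iterate_succ_apply', ih, hδ]
  simp only [Function.iterate_zero_apply, hit, map_neg, hneg] at h
  rw [sub_eq_add_neg, h, map_add, map_pow]
  abel

end PthPowers

namespace RingDerivation

/-! ### The maps `V_{p^j}` and the shift identity for `p`-polynomials. -/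

section PPolynomials

variable (C : Type*) {D : Type*} [Field C] [DivisionRing D] [Algebra C D] [Algebra.IsCentral C D]
  (δ : RingDerivation D) (p : ℕ) [Fact p.Prime] [CharP C p]

theorem Vpow_apply (j : ℕ) (b : C) : δ.Vpow C p j b =
    ∑ i ∈ Finset.range (j + 1), ((δ.centerDer C)^[p ^ i - 1] b) ^ p ^ (j - i) := rfl

theorem Vpow_zero (b : C) : δ.Vpow C p 0 b = b := by
  simp [Vpow_apply]

theorem Vpow_succ (j : ℕ) (b : C) : δ.Vpow C p (j + 1) b =
    δ.Vpow C p j b ^ p + (δ.centerDer C)^[p ^ (j + 1) - 1] b := by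
  rw [Vpow_apply, Vpow_apply, Finset.sum_range_succ, sum_pow_char, Nat.sub_self, pow_zero, pow_one]
  congr 1
  refine Finset.sum_congr rfl fun i hi => ?_
  rw [Finset.mem_range] at hi
  rw [← pow_mul, ← pow_succ, Nat.sub_add_comm (by omega)]

omit [Fact p.Prime] in
theorem centerDer_pow_char (b : C) : δ.centerDer C (b ^ p) = 0 := by
  rw [Derivation.leibniz_pow, ← Nat.cast_smul_eq_nsmul C, CharP.cast_eq_zero, zero_smul]

/-- All summands of `V_{p^j}(b)` but the last are `p`-th powers, which a single application of `δ`
kills; this is why `n ≠ 0` is needed. -/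
theorem iterate_centerDer_Vpow (j n : ℕ) (hn : n ≠ 0) (b : C) :
    (δ.centerDer C)^[n] (δ.Vpow C p j b) = (δ.centerDer C)^[n + (p ^ j - 1)] b := by
  cases j with
  | zero => simp [Vpow_zero]
  | succ j =>
    obtain ⟨m, rfl⟩ := Nat.exists_eq_succ_of_ne_zero hn
    rw [Vpow_succ, iterate_map_add, Function.iterate_succ_apply, centerDer_pow_char,
      iterate_map_zero, zero_add, ← Function.iterate_add_apply]

theorem centerDer_Vpow (j : ℕ) (b : C) :
    δ.centerDer C (δ.Vpow C p j b) = (δ.centerDer C)^[p ^ j] b := by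
  have h := iterate_centerDer_Vpow C δ p j 1 one_ne_zero b
  have hp : 0 < p ^ j := pow_pos (Fact.out : p.Prime).pos j
  rwa [Nat.add_sub_cancel' hp] at h

variable {R : Type*} [Ring R] [CharP R p] (φ : C →+* R) (x : R)

omit [CharP C p] in
theorem pow_mul_of_commutation (hx : ∀ c, x * φ c = φ c * x + φ (δ.centerDer C c)) (j : ℕ) (c : C) :
    x ^ p ^ j * φ c = φ c * x ^ p ^ j + φ ((δ.centerDer C)^[p ^ j] c) := by
  induction j generalizing c with
  | zero => simpa using hx c
  | succ j ih =>
    have h := pow_mul_eq_mul_pow_add_iterate p φ (x ^ p ^ j) (δ.centerDer C)^[p ^ j] ih c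
    rwa [← Function.iterate_mul, ← pow_mul, ← pow_succ] at h

/-- `(x - b) ^ (p ^ j) = x ^ (p ^ j) - V_{p ^ j}(b)` whenever `x c = c x + δ(c)` for `c ∈ C`. -/
theorem sub_pow_char_pow_of_commutation
    (hx : ∀ c, x * φ c = φ c * x + φ (δ.centerDer C c)) (j : ℕ) (b : C) :
    (x - φ b) ^ p ^ j = x ^ p ^ j - φ (δ.Vpow C p j b) := by
  have hp : p.Prime := Fact.out
  induction j with
  | zero => simp [Vpow_zero]
  | succ j ih =>
    -- Jacobson's formula is applied to `x ^ p ^ j`, which induces `δ^{p^j}`. The correction `δ^{p^j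
    -- (p-1)}(V_{p^j}(b))` collapses to `δ^{p^{j+1} - 1}(b)`, the new summand of `V_{p^{j+1}}(b)`.
    have h := sub_pow_char_of_commutation p φ (x ^ p ^ j) (δ.centerDer C)^[p ^ j]
      (iterate_map_neg _ _) (pow_mul_of_commutation C δ p φ x hx j) (δ.Vpow C p j b)
    have h1 : p ^ j * (p - 1) + (p ^ j - 1) = p ^ (j + 1) - 1 := by
      have h2 : 0 < p ^ j := pow_pos hp.pos j
      obtain ⟨m, rfl⟩ : ∃ m, p = m + 1 := ⟨p - 1, (Nat.sub_add_cancel hp.one_le).symm⟩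
      rw [Nat.add_sub_cancel, pow_succ, mul_add, mul_one, Nat.add_sub_assoc h2]
    have h2 : p ^ j * (p - 1) ≠ 0 :=
      mul_ne_zero (pow_ne_zero _ hp.ne_zero) (Nat.sub_ne_zero_of_lt hp.one_lt)
    rw [pow_succ, pow_mul, ih, h, ← pow_mul, ← pow_succ, Vpow_succ, ← h1,
      ← iterate_centerDer_Vpow C δ p j _ h2, Function.iterate_mul]

variable (e : ℕ) (a : ℕ → δ.constField C)

theorem V_apply (b : C) : δ.V C p e a b = δ.Vpow C p e b +
    ∑ i ∈ Finset.Icc 1 e, (a i : C) * δ.Vpow C p (e - i) b := by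
  simp [V, AddMonoidHom.finsetSum_apply]

/-- `g(x - b) = g(x) - V(b)` for the `p`-polynomial `g`. -/
theorem pPolynomial_sub (hx : ∀ c, x * φ c = φ c * x + φ (δ.centerDer C c)) (b : C) :
    (x - φ b) ^ p ^ e + ∑ i ∈ Finset.Icc 1 e, φ (a i) * (x - φ b) ^ p ^ (e - i) =
      x ^ p ^ e + ∑ i ∈ Finset.Icc 1 e, φ (a i) * x ^ p ^ (e - i) - φ (δ.V C p e a b) := by
  simp only [sub_pow_char_pow_of_commutation C δ p φ x hx, mul_sub, Finset.sum_sub_distrib,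
    V_apply, map_add, map_sum, map_mul]
  abel

end PPolynomials

/-! ### Values and kernel of `V`, via differential operators on `C`. -/

section Kernel

variable {C D : Type*} [Field C] [DivisionRing D] [Algebra C D] [Algebra.IsCentral C D]
  {δ : RingDerivation D}

variable (C δ) in
/-- Multiplication by elements of `C`, as `F`-linear endomorphisms of `C`. -/
noncomputable def lmulHom : C →+* Module.End (δ.constField C) C :=
  (Algebra.lmul (δ.constField C) C).toRingHom

theorem lmulHom_apply (b c : C) : δ.lmulHom C b c = b * c := rfl

theorem centerEnd_apply (c : C) : δ.centerEnd C c = δ.centerDer C c := rfl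

theorem coe_centerEnd_pow (n : ℕ) : ⇑(δ.centerEnd C ^ n) = (δ.centerDer C)^[n] :=
  Module.End.coe_pow _ _

theorem centerEnd_mul_smul (c : C) (T : Module.End (δ.constField C) C) :
    δ.centerEnd C * c • T = c • (δ.centerEnd C * T) + δ.centerDer C c • T := by
  ext x
  simp [centerEnd_apply, mul_comm]

/-- A Dedekind-type argument: commuting a relation `δ^n = ∑ c_i δ^i` of least order with `δ` gives
`∑ δ(c_i) δ^i = 0`. So the `c_i` are constants, and the relation is a polynomial over `F` of too
small degree annihilating `δ`. -/
theorem linearIndependent_centerEnd_pow {m : ℕ}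
    (hm : ∀ q : Polynomial (δ.constField C), q.Monic → Polynomial.aeval (δ.centerEnd C) q = 0 →
      m ≤ q.natDegree) (n : ℕ) (hn : n ≤ m) :
    LinearIndependent C fun i : Fin n => δ.centerEnd C ^ (i : ℕ) := by
  induction n with
  | zero => exact linearIndependent_empty_type
  | succ n ih =>
    rw [linearIndependent_finSucc']
    have ih := ih (by omega)
    refine ⟨ih, fun hmem => ?_⟩
    rw [Fin.val_last] at hmem
    change _ ∈ Submodule.span C (Set.range fun i : Fin n => δ.centerEnd C ^ (i : ℕ)) at hmem
    obtain ⟨c, hc⟩ := (Submodule.mem_span_range_iff_exists_fun C).1 hmem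
    have hcomm : ∑ i : Fin n, δ.centerDer C (c i) • δ.centerEnd C ^ (i : ℕ) = 0 := by
      have h1 : δ.centerEnd C * ∑ i : Fin n, c i • δ.centerEnd C ^ (i : ℕ)
          = (∑ i : Fin n, c i • δ.centerEnd C ^ (i : ℕ)) * δ.centerEnd C := by
        rw [hc, ← pow_succ, ← pow_succ']
      rw [Finset.mul_sum, Finset.sum_mul] at h1
      simp only [centerEnd_mul_smul, Finset.sum_add_distrib, smul_mul_assoc, ← pow_succ,
        ← pow_succ'] at h1
      simpa using h1
    have hc0 : ∀ i, δ.centerDer C (c i) = 0 := Fintype.linearIndependent_iff.1 ih _ hcomm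
    let r : Polynomial (δ.constField C) :=
      ∑ i : Fin n, Polynomial.C ⟨c i, hc0 i⟩ * Polynomial.X ^ (i : ℕ)
    have hr : r.degree < n := Polynomial.degree_sum_fin_lt _
    have hev : Polynomial.aeval (δ.centerEnd C) (Polynomial.X ^ n - r) = 0 := by
      rw [map_sub, map_pow, Polynomial.aeval_X, ← hc, map_sum, sub_eq_zero]
      refine Finset.sum_congr rfl fun i _ => ?_
      rw [map_mul, map_pow, Polynomial.aeval_X, Polynomial.aeval_C]
      ext x
      simp [Module.algebraMap_end_apply, Subfield.smul_def]
    have := hm _ (Polynomial.monic_X_pow_sub hr) hev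
    have hdeg : (Polynomial.X ^ n - r).degree = (n : WithBot ℕ) := by
      rw [Polynomial.degree_sub_eq_left_of_degree_lt (by rwa [Polynomial.degree_X_pow]),
        Polynomial.degree_X_pow]
    rw [Polynomial.natDegree_eq_of_degree_eq_some hdeg] at this
    omega

/-- Moving coefficients of `C` to the left past `δ` only creates terms of lower order, so `δ - b`
and `δ` have powers with the same leading term. A monic relation for `δ - b` thus becomes one for
`δ` over `C`. -/
theorem centerEnd_sub_pow_sub_mem_span (b : C) (n : ℕ) :
    (δ.centerEnd C - δ.lmulHom C b) ^ n - δ.centerEnd C ^ n ∈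
      Submodule.span C ((δ.centerEnd C ^ ·) '' Set.Iio n) := by
  set s : ℕ → Submodule C (Module.End (δ.constField C) C) :=
    fun n => Submodule.span C ((δ.centerEnd C ^ ·) '' Set.Iio n)
  have hs : Monotone s := fun m n h =>
    Submodule.span_mono (Set.image_mono (Set.Iio_subset_Iio h))
  have hmul : ∀ n, ∀ T ∈ s n, δ.centerEnd C * T ∈ s (n + 1) := by
    intro n T hT
    induction hT using Submodule.span_induction with
    | mem T hT =>
      obtain ⟨i, hi, rfl⟩ := hT
      exact Submodule.subset_span ⟨i + 1, Nat.succ_lt_succ hi, pow_succ' _ _⟩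
    | zero => simp
    | add T U _ _ h1 h2 => rw [mul_add]; exact add_mem h1 h2
    | smul c T hT h =>
      rw [centerEnd_mul_smul]
      exact add_mem (Submodule.smul_mem _ _ h) (Submodule.smul_mem _ _ (hs n.le_succ hT))
  have hlmul : ∀ T : Module.End (δ.constField C) C,
      δ.lmulHom C b * T = b • T := fun T => rfl
  change _ ∈ s n
  induction n with
  | zero => simp
  | succ n ih =>
    have h1 : (δ.centerEnd C - δ.lmulHom C b) ^ n ∈ s (n + 1) := by
      rw [← sub_add_cancel (_ ^ n) (δ.centerEnd C ^ n)]
      exact add_mem (hs n.le_succ ih) (Submodule.subset_span ⟨n, n.lt_succ_self, rfl⟩)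
    have h2 : (δ.centerEnd C - δ.lmulHom C b) ^ (n + 1)
          - δ.centerEnd C ^ (n + 1)
        = δ.centerEnd C * ((δ.centerEnd C - δ.lmulHom C b) ^ n
            - δ.centerEnd C ^ n)
          - b • (δ.centerEnd C - δ.lmulHom C b) ^ n := by
      rw [pow_succ', pow_succ', sub_mul, mul_sub, hlmul]
      abel
    rw [h2]
    exact sub_mem (hmul n _ ih) (Submodule.smul_mem _ _ h1)

/-- A monic polynomial over `F` of degree less than that of the minimum polynomial of `δ|_C` does
not annihilate any `δ - b`. -/
theorem aeval_centerEnd_sub_ne_zero {m : ℕ}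
    (hm : ∀ q : Polynomial (δ.constField C), q.Monic → Polynomial.aeval (δ.centerEnd C) q = 0 →
      m ≤ q.natDegree) (b : C) (q : Polynomial (δ.constField C)) (hq : q.Monic)
    (hqm : q.natDegree < m) :
    Polynomial.aeval (δ.centerEnd C - δ.lmulHom C b) q ≠ 0 := by
  intro h0
  set n := q.natDegree with hn
  set L := δ.centerEnd C - δ.lmulHom C b with hL
  set s : ℕ → Submodule C (Module.End (δ.constField C) C) :=
    fun n => Submodule.span C ((δ.centerEnd C ^ ·) '' Set.Iio n) with hs'
  have hs : Monotone s := fun m n h =>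
    Submodule.span_mono (Set.image_mono (Set.Iio_subset_Iio h))
  have hLn : ∀ i < n, L ^ i ∈ s n := fun i hi => by
    rw [← sub_add_cancel (L ^ i) (δ.centerEnd C ^ i)]
    exact add_mem (hs hi.le (centerEnd_sub_pow_sub_mem_span b i))
      (Submodule.subset_span ⟨i, hi, rfl⟩)
  have hmem : δ.centerEnd C ^ n ∈ s n := by
    rw [Polynomial.aeval_eq_sum_range, ← hn, Finset.sum_range_succ, hn, hq.coeff_natDegree,
      one_smul, ← hn] at h0
    have h1 : δ.centerEnd C ^ n = -(∑ i ∈ Finset.range n, q.coeff i • L ^ i)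
        - (L ^ n - δ.centerEnd C ^ n) := by
      rw [eq_neg_of_add_eq_zero_left h0]
      abel
    rw [h1]
    refine sub_mem (neg_mem (sum_mem fun i hi => ?_)) (centerEnd_sub_pow_sub_mem_span b n)
    exact Submodule.smul_mem _ (q.coeff i : C) (hLn i (Finset.mem_range.1 hi))
  have hli := (linearIndependent_finSucc'.1
    (linearIndependent_centerEnd_pow hm (n + 1) hqm)).2
  rw [Fin.val_last] at hli
  refine hli (Submodule.span_mono ?_ hmem)
  rintro _ ⟨i, hi, rfl⟩
  exact ⟨⟨i, hi⟩, rfl⟩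

variable (p : ℕ) [Fact p.Prime] [CharP C p] (e : ℕ) (a : ℕ → δ.constField C)

theorem centerEnd_mul_lmulHom (c : C) :
    δ.centerEnd C * δ.lmulHom C c =
      δ.lmulHom C c * δ.centerEnd C +
        δ.lmulHom C (δ.centerDer C c) := by
  ext x
  simp [centerEnd_apply, lmulHom_apply, mul_comm]

theorem lmulHom_coe (c : δ.constField C) :
    δ.lmulHom C (c : C) =
      algebraMap (δ.constField C) (Module.End (δ.constField C) C) c := by
  ext x
  simp [lmulHom_apply, Module.algebraMap_end_apply, Subfield.smul_def]

omit [CharP C p] in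
theorem degree_pPolynomial_tail_lt : (∑ i ∈ Finset.Icc 1 e,
    Polynomial.C (a i) * Polynomial.X ^ p ^ (e - i)).degree < ((p ^ e : ℕ) : WithBot ℕ) := by
  rw [← Polynomial.mem_degreeLT]
  refine sum_mem fun i hi => Polynomial.mem_degreeLT.2 ?_
  refine (Polynomial.degree_C_mul_X_pow_le _ _).trans_lt ?_
  rw [Finset.mem_Icc] at hi
  exact_mod_cast Nat.pow_lt_pow_right (Fact.out : p.Prime).one_lt (by omega)

omit [CharP C p] in
theorem monic_pPolynomial : (Polynomial.X ^ p ^ e +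
    ∑ i ∈ Finset.Icc 1 e, Polynomial.C (a i) * Polynomial.X ^ p ^ (e - i)).Monic :=
  Polynomial.monic_X_pow_add (degree_pPolynomial_tail_lt p e a)

omit [CharP C p] in
theorem X_dvd_pPolynomial : Polynomial.X ∣ Polynomial.X ^ p ^ e +
    ∑ i ∈ Finset.Icc 1 e, Polynomial.C (a i) * Polynomial.X ^ p ^ (e - i) := by
  have hp : ∀ k, p ^ k ≠ 0 := fun k => pow_ne_zero _ (Fact.out : p.Prime).ne_zero
  exact dvd_add (dvd_pow_self _ (hp _)) (Finset.dvd_sum fun i _ =>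
    (dvd_pow_self _ (hp _)).mul_left _)

omit [Fact p.Prime] [CharP C p] in
theorem aeval_pPolynomial {A : Type*} [Ring A] [Algebra (δ.constField C) A] (x : A) :
    Polynomial.aeval x (Polynomial.X ^ p ^ e + ∑ i ∈ Finset.Icc 1 e,
      Polynomial.C (a i) * Polynomial.X ^ p ^ (e - i)) =
    x ^ p ^ e + ∑ i ∈ Finset.Icc 1 e, algebraMap _ A (a i) * x ^ p ^ (e - i) := by
  simp

omit [Fact p.Prime] in
theorem charP_moduleEnd_constField : CharP (Module.End (δ.constField C) C) p := by
  have : CharP (δ.constField C) p :=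
    (RingHom.charP_iff (δ.constField C).subtype Subtype.val_injective p).2 inferInstance
  exact charP_of_injective_algebraMap (algebraMap (δ.constField C) _).injective p

/-- `g(δ - b) = -V(b)` as endomorphisms of `C`. -/
theorem aeval_minpoly_centerEnd_sub
    (hg : minpoly (δ.constField C) (δ.centerEnd C) = Polynomial.X ^ p ^ e +
      ∑ i ∈ Finset.Icc 1 e, Polynomial.C (a i) * Polynomial.X ^ p ^ (e - i)) (b : C) :
    Polynomial.aeval (δ.centerEnd C - δ.lmulHom C b)
      (minpoly (δ.constField C) (δ.centerEnd C)) =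
        -δ.lmulHom C (δ.V C p e a b) := by
  have := charP_moduleEnd_constField (C := C) (δ := δ) p
  have h := pPolynomial_sub C δ p (δ.lmulHom C) (δ.centerEnd C) e a
    (fun c => centerEnd_mul_lmulHom c) b
  have h0 := minpoly.aeval (δ.constField C) (δ.centerEnd C)
  rw [hg, aeval_pPolynomial] at h0 ⊢
  simp only [lmulHom_coe] at h
  rw [h0, zero_sub] at h
  exact h

/-- Differentiating turns each `V_{p^j}(b)` into `δ^{p^j}(b)`, so `δ(V(b)) = g(δ)(b)`, which
vanishes. -/
theorem V_mem_constField
    (hg : minpoly (δ.constField C) (δ.centerEnd C) = Polynomial.X ^ p ^ e +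
      ∑ i ∈ Finset.Icc 1 e, Polynomial.C (a i) * Polynomial.X ^ p ^ (e - i)) (b : C) :
    δ.V C p e a b ∈ δ.constField C := by
  have h0 := minpoly.aeval (δ.constField C) (δ.centerEnd C)
  rw [hg, aeval_pPolynomial] at h0
  have h1 := LinearMap.congr_fun h0 b
  change δ.centerDer C _ = 0
  have ha : ∀ i, δ.centerDer C (a i) = 0 := fun i => (a i).2
  rw [V_apply, map_add, map_sum]
  simp only [Derivation.leibniz, ha, centerDer_Vpow, smul_eq_mul]
  simpa [coe_centerEnd_pow, LinearMap.sum_apply, Module.algebraMap_end_apply,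
    Subfield.smul_def] using h1

theorem V_logDeriv_eq_zero
    (hg : minpoly (δ.constField C) (δ.centerEnd C) = Polynomial.X ^ p ^ e +
      ∑ i ∈ Finset.Icc 1 e, Polynomial.C (a i) * Polynomial.X ^ p ^ (e - i)) (c : C) (hc : c ≠ 0) :
    δ.V C p e a (δ.centerDer C c / c) = 0 := by
  set L := δ.centerEnd C - δ.lmulHom C (δ.centerDer C c / c) with hL
  have hLc : L c = 0 := by
    simp [hL, centerEnd_apply, lmulHom_apply, div_mul_cancel₀ _ hc]
  obtain ⟨q, hq⟩ := hg ▸ X_dvd_pPolynomial p e a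
  have h := LinearMap.congr_fun (aeval_minpoly_centerEnd_sub p e a hg (δ.centerDer C c / c)) c
  rw [hq, mul_comm, map_mul, Polynomial.aeval_X, Module.End.mul_apply, hLc, map_zero] at h
  simpa [lmulHom_apply, hc] using h

theorem exists_logDeriv_of_V_eq_zero
    (hg : minpoly (δ.constField C) (δ.centerEnd C) = Polynomial.X ^ p ^ e +
      ∑ i ∈ Finset.Icc 1 e, Polynomial.C (a i) * Polynomial.X ^ p ^ (e - i)) (b : C)
    (hb : δ.V C p e a b = 0) : ∃ c : C, c ≠ 0 ∧ b = δ.centerDer C c / c := by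
  by_contra! hcon
  set L := δ.centerEnd C - δ.lmulHom C b with hL
  have hinj : ∀ c, L c = 0 → c = 0 := by
    intro c hc
    by_contra hc0
    refine hcon c hc0 ?_
    rw [eq_div_iff hc0]
    exact (sub_eq_zero.1 hc).symm
  obtain ⟨q, hq⟩ := hg ▸ X_dvd_pPolynomial p e a
  have hmonic : (Polynomial.X * q).Monic := hq ▸ hg ▸ monic_pPolynomial p e a
  have hqmonic : q.Monic := Polynomial.monic_X.of_mul_monic_left hmonic
  -- The cofactor `q` of `X` in the minimum polynomial has degree one too small to annihilate any `δ
  -- - b`.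
  have hmin : ∀ r : Polynomial (δ.constField C), r.Monic →
      Polynomial.aeval (δ.centerEnd C) r = 0 → q.natDegree + 1 ≤ r.natDegree := by
    intro r hr h0
    have h := Polynomial.natDegree_le_natDegree (minpoly.min _ _ hr h0)
    rwa [hq, Polynomial.natDegree_X_mul hqmonic.ne_zero] at h
  refine aeval_centerEnd_sub_ne_zero hmin b q hqmonic (Nat.lt_succ_self _) ?_
  have h := aeval_minpoly_centerEnd_sub p e a hg b
  rw [hb, map_zero, neg_zero, hq, map_mul, Polynomial.aeval_X] at h
  ext c
  exact hinj _ (LinearMap.congr_fun h c)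

end Kernel

end RingDerivation

namespace DiffPoly

/-! ### Substitution endomorphisms of `D[t;δ]`. -/

section Substitution

variable {D : Type*} [Ring D] (δ : RingDerivation D)

/-- The embedding of `D` into `D[t;δ]`. -/
noncomputable def constHom : D →+* DiffPoly δ where
  toFun := const δ
  map_one' := Polynomial.C_1
  map_zero' := Polynomial.C_0
  map_add' _ _ := Polynomial.C_add
  map_mul' a b := by
    rw [const_mul]
    exact (Polynomial.smul_C (R := D) a b).symm

theorem constHom_injective : Function.Injective (constHom δ) := Polynomial.C_injective

theorem ofPoly_monomial (n : ℕ) (a : D) :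
    ofPoly δ (Polynomial.monomial n a) = const δ a * t δ ^ n := by
  have h : ∀ n, t δ ^ n = ofPoly δ (Polynomial.monomial n 1) := by
    intro n
    induction n with
    | zero => rfl
    | succ n ih =>
      rw [pow_succ', ih, t_mul]
      change tMul δ (Polynomial.monomial n 1) = Polynomial.monomial (n + 1) 1
      rw [tMul_monomial, δ.map_one_eq_zero, map_zero, add_zero]
  rw [h, const_mul]
  change _ = a • Polynomial.monomial n (1 : D)
  rw [Polynomial.smul_monomial, smul_eq_mul, mul_one]
  rfl

variable {δ} in
theorem induction_on {P : DiffPoly δ → Prop} (f : DiffPoly δ)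
    (add : ∀ f g, P f → P g → P (f + g)) (const_mul_t_pow : ∀ n a, P (const δ a * t δ ^ n)) :
    P f :=
  Polynomial.induction_on' (motive := P) f add fun n a =>
    (congrArg P (ofPoly_monomial δ n a)).mpr (const_mul_t_pow n a)

variable {δ} in
theorem ringHom_ext {R : Type*} [Ring R] {F G : DiffPoly δ →+* R}
    (hc : ∀ a, F (const δ a) = G (const δ a)) (ht : F (t δ) = G (t δ)) : F = G := by
  ext f
  induction f using induction_on with
  | add f g hf hg => rw [map_add, map_add, hf, hg]
  | const_mul_t_pow n a => rw [map_mul, map_mul, map_pow, map_pow, hc, ht]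

/-- The map `∑ aᵢ tⁱ ↦ ∑ aᵢ zⁱ`. -/
noncomputable def substFun (z : DiffPoly δ) : DiffPoly δ →+ DiffPoly δ where
  toFun f := (toPoly f).sum fun i a => const δ a * z ^ i
  map_zero' := Polynomial.sum_zero_index _
  map_add' f g := Polynomial.sum_add_index (toPoly f) (toPoly g) _
    (fun i => (congrArg (· * z ^ i) (constHom δ).map_zero).trans (zero_mul _))
    (fun i a b => (congrArg (· * z ^ i) ((constHom δ).map_add a b)).trans (add_mul _ _ _))

theorem substFun_const_mul_t_pow (z : DiffPoly δ) (n : ℕ) (a : D) :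
    substFun δ z (const δ a * t δ ^ n) = const δ a * z ^ n := by
  rw [← ofPoly_monomial]
  exact Polynomial.sum_monomial_index a (fun i a => const δ a * z ^ i)
    ((congrArg (· * z ^ n) (constHom δ).map_zero).trans (zero_mul _))

theorem const_mul_const (a b : D) : const δ a * const δ b = const δ (a * b) :=
  ((constHom δ).map_mul a b).symm

theorem substFun_const_mul (z : DiffPoly δ) (a : D) (f : DiffPoly δ) :
    substFun δ z (const δ a * f) = const δ a * substFun δ z f := by
  induction f using induction_on with
  | add f g hf hg => rw [mul_add, map_add, hf, hg, map_add, mul_add]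
  | const_mul_t_pow n b =>
    rw [← mul_assoc, const_mul_const, substFun_const_mul_t_pow, substFun_const_mul_t_pow,
      ← const_mul_const, mul_assoc]

variable {δ}

theorem substFun_t_mul {z : DiffPoly δ}
    (hz : ∀ a, z * const δ a = const δ a * z + const δ (δ a)) (f : DiffPoly δ) :
    substFun δ z (t δ * f) = z * substFun δ z f := by
  induction f using induction_on with
  | add f g hf hg => rw [mul_add, map_add, hf, hg, map_add, mul_add]
  | const_mul_t_pow n b =>
    rw [← mul_assoc, t_mul_const, add_mul, mul_assoc, ← pow_succ', map_add,
      substFun_const_mul_t_pow, substFun_const_mul_t_pow, substFun_const_mul_t_pow, ← mul_assoc, hz,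
      add_mul, mul_assoc, ← pow_succ']

/-- The ring endomorphism of `D[t;δ]` that fixes `D` and maps `t` to `z`. -/
noncomputable def substHom (z : DiffPoly δ)
    (hz : ∀ a, z * const δ a = const δ a * z + const δ (δ a)) : DiffPoly δ →+* DiffPoly δ where
  __ := substFun δ z
  map_one' := by
    have h := substFun_const_mul_t_pow δ z 0 1
    rw [pow_zero, pow_zero, mul_one] at h
    exact h
  map_mul' f g := by
    change substFun δ z (f * g) = substFun δ z f * substFun δ z g
    induction f using induction_on with
    | add f g hf hg => rw [add_mul, map_add, hf, hg, map_add, add_mul]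
    | const_mul_t_pow n a =>
      rw [mul_assoc, substFun_const_mul, substFun_const_mul_t_pow, mul_assoc]
      congr 1
      induction n with
      | zero => rw [pow_zero, pow_zero, one_mul, one_mul]
      | succ n ih => rw [pow_succ', pow_succ', mul_assoc, mul_assoc, substFun_t_mul hz, ih]

variable {z : DiffPoly δ} (hz : ∀ a, z * const δ a = const δ a * z + const δ (δ a))

theorem substHom_const (a : D) : substHom z hz (const δ a) = const δ a := by
  have h := substFun_const_mul_t_pow δ z 0 a
  rw [pow_zero, pow_zero, mul_one] at h
  exact h

theorem substHom_t : substHom z hz (t δ) = z := by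
  have h := substFun_const_mul_t_pow δ z 1 1
  have h1 : const δ (1 : D) = 1 := (constHom δ).map_one
  rw [pow_one, pow_one, h1, one_mul, one_mul] at h
  exact h

theorem natDegree_pow_le (hd : (toPoly z).natDegree ≤ 1) (n : ℕ) :
    (toPoly (z ^ n)).natDegree ≤ n := by
  induction n with
  | zero => exact Polynomial.natDegree_one.le
  | succ n ih =>
    rw [pow_succ]
    exact (coeff_mulFun δ _ _ n 1 ih hd).1

theorem degree_substHom_lt (hd : (toPoly z).natDegree ≤ 1) (n : ℕ) (f : DiffPoly δ)
    (hf : (toPoly f).degree < n) : (toPoly (substHom z hz f)).degree < n := by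
  rw [← Polynomial.mem_degreeLT]
  change (toPoly f).sum (fun i a => const δ a * z ^ i) ∈ Polynomial.degreeLT D n
  rw [Polynomial.sum]
  refine Submodule.sum_mem (Polynomial.degreeLT D n) fun i hi => ?_
  rw [const_mul]
  refine Submodule.smul_mem (Polynomial.degreeLT D n) _ (Polynomial.mem_degreeLT.2 ?_)
  refine Polynomial.degree_le_natDegree.trans_lt ?_
  have h1 := (Polynomial.le_degree_of_mem_supp i hi).trans_lt hf
  have h2 := natDegree_pow_le hd i
  norm_cast at h1 ⊢
  exact lt_of_le_of_lt h2 h1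

end Substitution

/-! ### The shifts `t ↦ t - b` for central `b`. -/

section Shift

variable {C D : Type*} [Field C] [DivisionRing D] [Algebra C D]
  {δ : RingDerivation D}

/-- Centrality of `b` makes `t - b` satisfy the same commutation rule as `t`, so it is an admissible
target for substitution. -/
theorem t_add_const_mul_const (b : C) (a : D) :
    (t δ + const δ (-algebraMap C D b)) * const δ a
      = const δ a * (t δ + const δ (-algebraMap C D b)) + const δ (δ a) := by
  rw [add_mul, mul_add, t_mul_const, const_mul_const, const_mul_const, neg_mul, mul_neg,
    Algebra.commutes]
  abel

variable (δ) in
/-- The ring endomorphism `G_{id,-b}` of `D[t;δ]` for `b` in the center `C` of `D`. -/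
noncomputable def shift (b : C) : DiffPoly δ →+* DiffPoly δ :=
  substHom (t δ + const δ (-algebraMap C D b)) (t_add_const_mul_const b)

theorem shift_const (b : C) (a : D) : shift δ b (const δ a) = const δ a := substHom_const _ a

theorem shift_smul (b : C) (a : D) (f : DiffPoly δ) : shift δ b (a • f) = a • shift δ b f := by
  rw [← const_mul, map_mul, shift_const, const_mul]

variable (δ) in
/-- The embedding of the center `C` of `D` into `D[t;δ]`. -/
noncomputable def centerHom : C →+* DiffPoly δ := (constHom δ).comp (algebraMap C D)

theorem shift_t (b : C) : shift δ b (t δ) = t δ - centerHom δ b := by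
  rw [shift, substHom_t, sub_eq_add_neg]
  exact congrArg (t δ + ·) ((constHom δ).map_neg _)

theorem shift_centerHom (b c : C) : shift δ b (centerHom δ c) = centerHom δ c := shift_const _ _

theorem shift_shift (b c : C) (f : DiffPoly δ) : shift δ b (shift δ c f) = shift δ (b + c) f := by
  refine RingHom.congr_fun (ringHom_ext (F := (shift δ b).comp (shift δ c)) (fun a => ?_) ?_) f
  · simp [shift_const]
  · simp [shift_t, shift_centerHom, sub_sub]

theorem shift_zero (f : DiffPoly δ) : shift δ (0 : C) f = f := by
  refine RingHom.congr_fun (ringHom_ext (G := RingHom.id _) (fun a => ?_) ?_) f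
  · simp [shift_const]
  · simp [shift_t]

theorem degree_shift_lt (b : C) (n : ℕ) (f : DiffPoly δ) (hf : (toPoly f).degree < n) :
    (toPoly (shift δ b f)).degree < n :=
  degree_substHom_lt _ (Polynomial.natDegree_add_le_of_degree_le Polynomial.natDegree_X_le
    ((Polynomial.natDegree_C _).le.trans zero_le_one)) n f hf

theorem shift_mem_petitSubmodule (b : C) (f g : DiffPoly δ) (hg : g ∈ petitSubmodule f) :
    shift δ b g ∈ petitSubmodule f := by
  rcases hg with hg | rfl
  · have hf : toPoly f ≠ 0 := by
      intro h
      rw [h, Polynomial.degree_zero] at hg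
      exact not_lt_bot hg
    rw [Polynomial.degree_eq_natDegree hf] at hg
    refine Or.inl ?_
    rw [Polynomial.degree_eq_natDegree hf]
    exact degree_shift_lt b _ g hg
  · exact Or.inr (map_zero _)

/-- Shifting a division `g = q f + r` gives a division of the shifted `g` by the same `f`, with
remainder still of small degree; uniqueness of remainders concludes. -/
theorem shift_modRight {b : C} {f : DiffPoly δ} (hf : shift δ b f = f) (g : DiffPoly δ) :
    shift δ b (modRight g f) = modRight (shift δ b g) f := by
  by_cases h0 : f = 0
  · simp [modRight, h0]
  · obtain ⟨⟨q, h1⟩, h2⟩ := modRight_spec g f h0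
    refine (modRight_eq (q := shift δ b q) ?_ ?_).symm
    · conv_lhs => rw [h1]
      rw [map_add, map_mul, hf]
    · rcases shift_mem_petitSubmodule b f _ (Or.inl h2) with h | h
      · exact h
      · rw [h]
        exact bot_le.trans_lt h2

variable (C δ) in
theorem charP (p : ℕ) [CharP C p] : CharP (DiffPoly δ) p :=
  (RingHom.charP_iff (centerHom (C := C) δ)
    ((constHom_injective δ).comp (algebraMap C D).injective) p).1 inferInstance

variable [Algebra.IsCentral C D]

theorem t_mul_centerHom (c : C) :
    t δ * centerHom δ c = centerHom δ c * t δ + centerHom δ (δ.centerDer C c) := by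
  have h := t_mul_const δ (algebraMap C D c)
  rwa [← RingDerivation.algebraMap_centerDer] at h

variable (p : ℕ) [Fact p.Prime] [CharP C p]

theorem t_sub_centerHom_pow (j : ℕ) (b : C) :
    (t δ - centerHom δ b) ^ p ^ j = t δ ^ p ^ j - centerHom δ (δ.Vpow C p j b) :=
  have := charP C δ p
  RingDerivation.sub_pow_char_pow_of_commutation C δ p (centerHom δ) (t δ) t_mul_centerHom j b

variable (e : ℕ) (a : ℕ → δ.constField C)

omit [Fact p.Prime] [CharP C p] in
-- `ofPoly` is not multiplicative in general, so the comparison of `g` with its value at `t` is made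
-- monomial by monomial.
theorem ofPoly_map_pPolynomial :
    ofPoly δ ((Polynomial.X ^ p ^ e + ∑ i ∈ Finset.Icc 1 e,
      Polynomial.C (a i) * Polynomial.X ^ p ^ (e - i)).map (δ.constEmb C)) =
    t δ ^ p ^ e + ∑ i ∈ Finset.Icc 1 e, centerHom δ (a i : C) * t δ ^ p ^ (e - i) := by
  have h1 : (1 : DiffPoly δ) = const δ 1 := rfl
  rw [← one_mul (t δ ^ p ^ e), h1, ← ofPoly_monomial]
  simp only [Polynomial.map_add, Polynomial.map_pow, Polynomial.map_X, Polynomial.map_sum,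
    Polynomial.map_mul, Polynomial.map_C]
  change _ = ofPoly δ _ + ∑ i ∈ Finset.Icc 1 e, const δ (δ.constEmb C (a i)) * t δ ^ p ^ (e - i)
  simp only [← ofPoly_monomial, Polynomial.X_pow_eq_monomial, Polynomial.C_mul_monomial, mul_one]
  rfl

theorem shift_eq_self {b : C} (hb : δ.V C p e a b = 0) (d : D) :
    shift δ b (ofPoly δ ((Polynomial.X ^ p ^ e + ∑ i ∈ Finset.Icc 1 e,
      Polynomial.C (a i) * Polynomial.X ^ p ^ (e - i)).map (δ.constEmb C)) - const δ d) =
    ofPoly δ ((Polynomial.X ^ p ^ e + ∑ i ∈ Finset.Icc 1 e,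
      Polynomial.C (a i) * Polynomial.X ^ p ^ (e - i)).map (δ.constEmb C)) - const δ d := by
  have := charP C δ p
  have h := RingDerivation.pPolynomial_sub C δ p (centerHom δ) (t δ) e a t_mul_centerHom b
  rw [hb, map_zero, sub_zero] at h
  rw [ofPoly_map_pPolynomial, map_sub, shift_const, map_add, map_sum]
  simp only [map_mul, map_pow, shift_t, shift_centerHom, h]

end Shift

end DiffPoly

/-! ### Shifts as automorphisms of `S_f`. -/

namespace PetitAlgebra

variable {C D : Type*} [Field C] [DivisionRing D] [Algebra C D]
  {δ : RingDerivation D} {f : DiffPoly δ}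

/-- The restriction of `G_{id,-b}` to `S_f`. -/
noncomputable def shift (b : C) (x : PetitAlgebra f) : PetitAlgebra f :=
  (⟨DiffPoly.shift δ b x.val, DiffPoly.shift_mem_petitSubmodule b f _ x.2⟩ : petitSubmodule f)

theorem val_shift (b : C) (x : PetitAlgebra f) : (shift b x).val = DiffPoly.shift δ b x.val := rfl

theorem shift_shift (b c : C) (x : PetitAlgebra f) : shift b (shift c x) = shift (b + c) x :=
  val_injective (DiffPoly.shift_shift b c _)

theorem shift_zero (x : PetitAlgebra f) : shift (0 : C) x = x :=
  val_injective (DiffPoly.shift_zero _)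

theorem shift_mul {b : C} (hf : DiffPoly.shift δ b f = f) (x y : PetitAlgebra f) :
    shift b (x * y) = shift b x * shift b y :=
  val_injective (by simp only [val_shift, val_mul, DiffPoly.shift_modRight hf, map_mul])

variable [Algebra.IsCentral C D]

variable (f) in
/-- `G_{id,-b}` as an `F`-linear automorphism of the vector space `S_f`. -/
noncomputable def shiftEquiv (b : C) : PetitAlgebra f ≃ₗ[δ.constField C] PetitAlgebra f where
  toFun := shift b
  invFun := shift (-b)
  left_inv x := by rw [shift_shift, neg_add_cancel, shift_zero]
  right_inv x := by rw [shift_shift, add_neg_cancel, shift_zero]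
  map_add' x y := val_injective (map_add (DiffPoly.shift δ b) _ _)
  map_smul' a x := val_injective (DiffPoly.shift_smul b (δ.constEmb C a) _)

/-- `b ↦ G_{id,-b}` as a homomorphism to `Aut_F(S_f)`, on a subgroup of `C` whose shifts fix `f`. -/
noncomputable def shiftAut (K : AddSubgroup C) (hK : ∀ b ∈ K, DiffPoly.shift δ b f = f) :
    Multiplicative K →* autF C f where
  toFun b := ⟨shiftEquiv f (Multiplicative.toAdd b : K),
    shift_mul (hK _ (Multiplicative.toAdd b).2)⟩
  map_one' := Subtype.ext (LinearEquiv.ext fun x => shift_zero x)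
  map_mul' _ _ := Subtype.ext (LinearEquiv.ext fun x => (shift_shift _ _ x).symm)

/-- When `deg f > 1`, the element `t` lies in `S_f`, and its image `t - b` determines `b`. -/
theorem shiftAut_injective {K : AddSubgroup C} (hK : ∀ b ∈ K, DiffPoly.shift δ b f = f)
    (hf : 1 < (DiffPoly.toPoly f).degree) : Function.Injective (shiftAut K hK) := by
  rw [injective_iff_map_eq_one]
  intro b hb
  have ht : DiffPoly.t δ ∈ petitSubmodule f := Or.inl (Polynomial.degree_X_le.trans_lt hf)
  let x : PetitAlgebra f := (⟨DiffPoly.t δ, ht⟩ : petitSubmodule f)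
  have h1 : DiffPoly.shift δ (Multiplicative.toAdd b : K).1 (DiffPoly.t δ) = DiffPoly.t δ :=
    congrArg (fun φ : autF C f => (φ.1 x).val) hb
  rw [DiffPoly.shift_t, sub_eq_self] at h1
  have h2 : (Multiplicative.toAdd b : K).1 = 0 :=
    (algebraMap C D).injective
      ((DiffPoly.constHom_injective δ (h1.trans (map_zero _).symm)).trans (map_zero _).symm)
  exact Subtype.ext h2

end PetitAlgebra

/-! ### Degree of `f` and the main theorem. -/

theorem DiffPoly.one_lt_degree_map_pPolynomial_sub_const {C D : Type*} [Field C] [DivisionRing D]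
    [Algebra C D] [Algebra.IsCentral C D] (p : ℕ) [Fact p.Prime]
    (δ : RingDerivation D) (e : ℕ) (he : e ≠ 0) (a : ℕ → δ.constField C) (d : D) :
    1 < (toPoly (ofPoly δ ((Polynomial.X ^ p ^ e + ∑ i ∈ Finset.Icc 1 e,
      Polynomial.C (a i) * Polynomial.X ^ p ^ (e - i)).map (δ.constEmb C)) - const δ d)).degree := by
  change 1 < ((Polynomial.X ^ p ^ e + ∑ i ∈ Finset.Icc 1 e,
      Polynomial.C (a i) * Polynomial.X ^ p ^ (e - i)).map (δ.constEmb C) - Polynomial.C d).degree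
  have h1 : (1 : WithBot ℕ) < ((Polynomial.X ^ p ^ e + ∑ i ∈ Finset.Icc 1 e,
      Polynomial.C (a i) * Polynomial.X ^ p ^ (e - i)).map (δ.constEmb C)).degree := by
    rw [(RingDerivation.monic_pPolynomial p e a).degree_map,
      Polynomial.degree_add_eq_left_of_degree_lt (by
        rw [Polynomial.degree_X_pow]
        exact RingDerivation.degree_pPolynomial_tail_lt p e a),
      Polynomial.degree_X_pow]
    exact_mod_cast Nat.one_lt_pow he (Fact.out : p.Prime).one_lt
  rwa [Polynomial.degree_sub_C (zero_lt_one.trans h1)]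

theorem mainTheorem9 {C D : Type*} [Field C] [DivisionRing D] [Algebra C D]
    [Algebra.IsCentral C D] [FiniteDimensional C D] (p : ℕ) [Fact p.Prime] [CharP C p]
    (δ : RingDerivation D) (e : ℕ) (a : ℕ → δ.constField C)
    (hg : minpoly (δ.constField C) (δ.centerEnd C) =
      Polynomial.X ^ p ^ e +
        ∑ i ∈ Finset.Icc 1 e, Polynomial.C (a i) * Polynomial.X ^ p ^ (e - i))
    (d : D) (f : DiffPoly δ)
    (hf : f = DiffPoly.ofPoly δ
        ((minpoly (δ.constField C) (δ.centerEnd C)).map (δ.constEmb C)) - DiffPoly.const δ d) :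
    (∀ (j : ℕ) (b : C),
      (DiffPoly.t δ - DiffPoly.const δ (algebraMap C D b)) ^ p ^ j =
        DiffPoly.t δ ^ p ^ j - DiffPoly.const δ (algebraMap C D (δ.Vpow C p j b))) ∧
    (∀ b : C, δ.V C p e a b ∈ δ.constField C) ∧
    {b : C | δ.V C p e a b = 0} = {b : C | ∃ c : C, c ≠ 0 ∧ b = δ.centerDer C c / c} ∧
    ∃ H : Subgroup (PetitAlgebra.autF C f),
      (∀ φ : PetitAlgebra.autF C f, φ ∈ H ↔ ∃ b : C, δ.V C p e a b = 0 ∧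
        ∀ x : PetitAlgebra f,
          (φ.1 x).val = DiffPoly.G δ (RingEquiv.refl D) (-algebraMap C D b) x.val) ∧
      ∃ Φ : Multiplicative (δ.V C p e a).ker ≃* H,
        ∀ (b : (δ.V C p e a).ker) (x : PetitAlgebra f),
          ((Φ (Multiplicative.ofAdd b)).1.1 x).val =
            DiffPoly.G δ (RingEquiv.refl D) (-algebraMap C D b.1) x.val := by
  have hfix : ∀ b ∈ (δ.V C p e a).ker, DiffPoly.shift δ b f = f := by
    intro b hb
    rw [hf, hg]
    exact DiffPoly.shift_eq_self p e a hb d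
  refine ⟨fun j b => DiffPoly.t_sub_centerHom_pow p j b,
    RingDerivation.V_mem_constField p e a hg, Set.ext fun b => ?_,
    (PetitAlgebra.shiftAut _ hfix).range, fun φ => ?_, ?_⟩
  · refine ⟨RingDerivation.exists_logDeriv_of_V_eq_zero p e a hg b, ?_⟩
    rintro ⟨c, hc, rfl⟩
    exact RingDerivation.V_logDeriv_eq_zero p e a hg c hc
  · constructor
    · rintro ⟨b, rfl⟩
      -- The shift was built by substituting `t + const (-b)`, so it unfolds to the sum defining
      -- `G`.
      exact ⟨(Multiplicative.toAdd b).1, (Multiplicative.toAdd b).2, fun x => rfl⟩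
    · rintro ⟨b, hb, h⟩
      exact ⟨Multiplicative.ofAdd ⟨b, hb⟩, Subtype.ext (LinearEquiv.ext fun x =>
        PetitAlgebra.val_injective (h x).symm)⟩
  · have hinj : Function.Injective (PetitAlgebra.shiftAut _ hfix) := by
      -- For `e = 0` the degree of `f` is 1 and `t` is not in `S_f`, but then `V(b) = b`, so the
      -- kernel is trivial.
      rcases eq_or_ne e 0 with rfl | he
      · rw [injective_iff_map_eq_one]
        intro b _
        have hb : δ.V C p 0 a (Multiplicative.toAdd b).1 = 0 := (Multiplicative.toAdd b).2
        rw [RingDerivation.V_apply, RingDerivation.Vpow_zero] at hb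
        rw [Finset.Icc_eq_empty (by omega), Finset.sum_empty, add_zero] at hb
        exact Subtype.ext hb
      · refine PetitAlgebra.shiftAut_injective hfix ?_
        rw [hf, hg]
        exact DiffPoly.one_lt_degree_map_pPolynomial_sub_const p δ e he a d
    exact ⟨MonoidHom.ofInjective hinj, fun b x => rfl⟩
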